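/- Lemma 3 (Optimal power split). Consider a transmitter at the origin of $\mathbb{R}^2$ with transmit power $P_t>0$, a legitimate receiver at distance $d>0$ from it, and eavesdroppers whose locations form a homogeneous Poisson point process $\Phi_e\subset\mathbb{R}^2$ of density $\lambda_e>0$. Let $h\sim\exp(1)$ be the fading coefficient of the legitimate link, and let $g_y\sim\exp(1)$ be that of the link to the eavesdropper at $y\in\Phi_e$; all fading coefficients are independent of each other and of $\Phi_e$. Let $\alpha>2$ be the path-loss exponent, $\sigma_P^2,\sigma_S^2>0$ the noise powers at the legitimate receiver and at the eavesdroppers, and $\beta_t,\beta_e>0$ the corresponding SNR thresholds. A fraction $\gamma\in[0,1]$ of the power is used for the information signal and the rest for artificial noise, which disturbs only the eavesdroppers. Let $y^*=\arg\max_{y\in\Phi_e} g_y\|y\|^{-\alpha}$ be the strongest eavesdropper; the maximum is attained almost surely. Put $$P_{\rm cov}^{AN}(\gamma)=\mathbb{P}\left(\frac{\gamma P_t h d^{-\alpha}}{\sigma_P^2}\ge\beta_t\right),\qquad P_{\rm sec}^{AN}(\gamma)=\mathbb{P}\left(\frac{\gamma P_t g_{y^*}\|y^*\|^{-\alpha}}{(1-\gamma)P_t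 g_{y^*}\|y^*\|^{-\alpha}+\sigma_S^2}\le\beta_e\right).$$ Then for every $\epsilon\in(0,1]$ there is exactly one $\gamma^*\in[0,1]$ that maximizes $P_{\rm cov}^{AN}(\gamma)$ among all $\gamma\in[0,1]$ with $P_{\rm sec}^{AN}(\gamma)\ge\epsilon$, namely $$\gamma^*=\min\left\{1,\ \frac{\beta_e}{1+\beta_e}\left(1+\frac{\sigma_S^2}{P_t}\left(\frac{\alpha\log(1/\epsilon)}{2\pi\lambda_e\Gamma(2/\alpha)}\right)^{\alpha/2}\right)\right\}.$$ -/

import Mathlib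

open MeasureTheory ProbabilityTheory Set

noncomputable section

/-- The plane `ℝ²` with the Euclidean norm and Lebesgue measure. -/
abbrev Plane : Type := EuclideanSpace ℝ (Fin 2)

/-- The number `N(B)` of points of the configuration `(y i)` that lie in `B`. -/
def pointCount {Ω : Type*} (y : ℕ → Ω → Plane) (B : Set Plane) (ω : Ω) : ℕ∞ :=
  {i : ℕ | y i ω ∈ B}.encard

/-- `{y i}` is a homogeneous Poisson point process on `ℝ²` with density `lam`: the number of points
in a Borel set of finite area is Poisson distributed with mean `lam` times the area, and the numbers
of points in finitely many pairwise disjoint such sets are independent.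
(For `lam > 0` the process has infinitely many points almost surely, so `ℕ` can serve as the index
set of an enumeration of its points.) -/
structure IsPoissonProcess {Ω : Type*} [MeasurableSpace Ω] (μ : Measure Ω) (lam : ℝ)
    (y : ℕ → Ω → Plane) : Prop where
  measurable : ∀ i, Measurable (y i)
  count_law : ∀ B : Set Plane, MeasurableSet B → volume B ≠ ⊤ →
    HasLaw (pointCount y B)
      ((poissonMeasure (lam * volume.real B).toNNReal).map (Nat.cast : ℕ → ℕ∞)) μ
  count_indep : ∀ (n : ℕ) (B : Fin n → Set Plane), (∀ k, MeasurableSet (B k)) →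
    (∀ k, volume (B k) ≠ ⊤) → Pairwise (fun k l => Disjoint (B k) (B l)) →
    iIndepFun (fun k => pointCount y (B k)) μ

/-- The random elements of the network: the eavesdroppers `{y i}` form a Poisson point process of
density `lam`; the fading coefficient `h` of the legitimate link and the fading coefficients `g i`
of the links to the eavesdroppers `y i` are `exp(1)`-distributed; the fading coefficients are
independent of each other and of the locations of the eavesdroppers. -/
structure IsFadingNetwork {Ω : Type*} [MeasurableSpace Ω] (μ : Measure Ω) (lam : ℝ)
    (h : Ω → ℝ) (y : ℕ → Ω → Plane) (g : ℕ → Ω → ℝ) : Prop where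
  poisson : IsPoissonProcess μ lam y
  measurable_h : Measurable h
  measurable_g : ∀ i, Measurable (g i)
  law_h : HasLaw h (expMeasure 1) μ
  law_g : ∀ i, HasLaw (g i) (expMeasure 1) μ
  indep_g : iIndepFun g μ
  indep_g_y : IndepFun (fun ω i => g i ω) (fun ω i => y i ω) μ
  indep_h : IndepFun h (fun ω => ((fun i => g i ω), (fun i => y i ω))) μ

/-- The channel gain `g_y ‖y‖^(-α)` from the transmitter (at the origin) to the eavesdropper
`y i`. -/
def eveGain {Ω : Type*} (α : ℝ) (y : ℕ → Ω → Plane) (g : ℕ → Ω → ℝ) (i : ℕ) (ω : Ω) : ℝ :=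
  g i ω * ‖y i ω‖ ^ (-α)

/-- The eavesdropper `y i` has the largest channel gain among all eavesdroppers. -/
def IsStrongest {Ω : Type*} (α : ℝ) (y : ℕ → Ω → Plane) (g : ℕ → Ω → ℝ) (ω : Ω) (i : ℕ) : Prop :=
  ∀ j, eveGain α y g j ω ≤ eveGain α y g i ω

/-- The index of the strongest eavesdropper `y^*` (arbitrary if there is none). -/
def strongest {Ω : Type*} (α : ℝ) (y : ℕ → Ω → Plane) (g : ℕ → Ω → ℝ) (ω : Ω) : ℕ :=
  Classical.epsilon (IsStrongest α y g ω)

/-- The SNR at the legitimate receiver, at distance `d` from the transmitter, when the fraction `γ`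
of the power `Pt` is used for the information signal and the noise power is `σP ^ 2`. -/
def snrP {Ω : Type*} (α Pt d σP : ℝ) (h : Ω → ℝ) (γ : ℝ) (ω : Ω) : ℝ :=
  γ * Pt * h ω * d ^ (-α) / σP ^ 2

/-- The SNR at the strongest eavesdropper, which suffers from its noise, of power `σS ^ 2`, and from
the artificial noise, which is sent with power `(1 - γ) * Pt`. -/
def snrS {Ω : Type*} (α Pt σS : ℝ) (y : ℕ → Ω → Plane) (g : ℕ → Ω → ℝ) (γ : ℝ) (ω : Ω) : ℝ :=
  γ * Pt * eveGain α y g (strongest α y g ω) ω /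
    ((1 - γ) * Pt * eveGain α y g (strongest α y g ω) ω + σS ^ 2)

/-- The coverage probability `P(SNR_P ≥ βt)`. -/
def covProb {Ω : Type*} [MeasurableSpace Ω] (μ : Measure Ω) (α Pt d σP βt : ℝ) (h : Ω → ℝ)
    (γ : ℝ) : ℝ :=
  μ.real {ω | βt ≤ snrP α Pt d σP h γ ω}

/-- The secure communication probability `P(SNR_S ≤ βe)`. -/
def secProb {Ω : Type*} [MeasurableSpace Ω] (μ : Measure Ω) (α Pt σS βe : ℝ)
    (y : ℕ → Ω → Plane) (g : ℕ → Ω → ℝ) (γ : ℝ) : ℝ :=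
  μ.real {ω | snrS α Pt σS y g γ ω ≤ βe}

/-- `γ` is an optimal power split: among all fractions in `[0, 1]` whose secure communication
probability is at least `ε`, it maximizes the coverage probability. -/
def IsOptimalSplit {Ω : Type*} [MeasurableSpace Ω] (μ : Measure Ω) (α Pt d σP σS βt βe ε : ℝ)
    (h : Ω → ℝ) (y : ℕ → Ω → Plane) (g : ℕ → Ω → ℝ) (γ : ℝ) : Prop :=
  γ ∈ {c ∈ Icc (0 : ℝ) 1 | ε ≤ secProb μ α Pt σS βe y g c} ∧
    IsMaxOn (covProb μ α Pt d σP βt h)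
      {c ∈ Icc (0 : ℝ) 1 | ε ≤ secProb μ α Pt σS βe y g c} γ

end

/-! Almost surely all gains are positive and a largest gain `G` exists. For `G > 0` the secrecy
condition clears to `Pt * u * G ≤ βe * σS ^ 2` with `u = γ * (1 + βe) - βe`. If `u ≤ 0` it holds
almost surely; otherwise it bounds `G` by a threshold `t`.

The law of `G` comes from the Laplace functional of the Poisson process. Given the locations, `P(∀
i, g i ≤ φ (y i))` is the product of the factors `1 - exp (-φ (y i))`. Writing this product as `exp
(-∑ f (y i))` and averaging gives `exp (-lam * ∫ exp (-φ))` (`IsFadingNetwork.measure_forall_le`).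
For `φ x = t * ‖x‖ ^ α` the integral is a Gamma value.

Solving `P(G ≤ t) ≥ ε` for `γ` gives an upper bound `γ₀` (`IsFadingNetwork.le_secProb_iff`), so the
feasible set is `[0, min 1 γ₀]`. The coverage probability is strictly increasing there, hence its
unique maximizer is the right endpoint. -/

noncomputable section

open Filter Topology
open scoped ENNReal NNReal

/-! ### The exponential on `[0, ∞]` and Poisson expectations -/

/-- The function `x ↦ exp (-x)` on `[0, ∞]`, with `exp (-∞) = 0`. -/
def expNeg (x : ℝ≥0∞) : ℝ≥0∞ := EReal.exp (-(x : EReal))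

theorem expNeg_zero : expNeg 0 = 1 := by simp [expNeg]

theorem expNeg_ofReal {x : ℝ} (hx : 0 ≤ x) :
    expNeg (ENNReal.ofReal x) = ENNReal.ofReal (Real.exp (-x)) := by
  rw [expNeg, EReal.coe_ennreal_ofReal, max_eq_left hx, ← EReal.coe_neg, EReal.exp_coe]

theorem expNeg_add (x y : ℝ≥0∞) : expNeg (x + y) = expNeg x * expNeg y := by
  simp only [expNeg, EReal.exp_neg, EReal.coe_ennreal_add, EReal.exp_add]
  apply ENNReal.mul_inv
  · left; simp
  · right; simp

theorem continuous_expNeg : Continuous expNeg :=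
  ENNReal.continuous_exp.comp (continuous_neg.comp continuous_coe_ennreal_ereal)

theorem measurable_expNeg : Measurable expNeg := continuous_expNeg.measurable

theorem antitone_expNeg : Antitone expNeg := fun x y h => by
  simpa [expNeg] using h

theorem expNeg_le_one (x : ℝ≥0∞) : expNeg x ≤ 1 := by
  simpa [expNeg_zero] using antitone_expNeg (zero_le : 0 ≤ x)

theorem expNeg_sum {ι : Type*} (s : Finset ι) (f : ι → ℝ≥0∞) :
    expNeg (∑ i ∈ s, f i) = ∏ i ∈ s, expNeg (f i) := by
  classical
  induction s using Finset.induction_on with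
  | empty => simp [expNeg_zero]
  | insert a s ha ih => rw [Finset.sum_insert ha, Finset.prod_insert ha, expNeg_add, ih]

theorem expNeg_mul_natCast (c : ℝ≥0∞) (n : ℕ) : expNeg (c * n) = expNeg c ^ n := by
  induction n with
  | zero => simp [expNeg_zero]
  | succ n ih => rw [Nat.cast_succ, mul_add, mul_one, expNeg_add, ih, pow_succ]

/-- Lets a product of probabilities be read as a Laplace functional; the factor `0` is allowed and
corresponds to the exponent `∞`. -/
theorem expNeg_neg_log {x : ℝ≥0∞} (hx : x ≤ 1) :
    expNeg (-(ENNReal.log x)).toENNReal = x := by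
  rw [expNeg, EReal.coe_toENNReal, neg_neg, ENNReal.exp_log]
  simpa using hx

/-- The probability generating function of the Poisson distribution. -/
theorem lintegral_expNeg_poissonMeasure (r : ℝ≥0) (c : ℝ≥0∞) :
    ∫⁻ n, expNeg (c * (n : ℝ≥0∞)) ∂(poissonMeasure r) = expNeg (r * (1 - expNeg c)) := by
  obtain ⟨q, hq⟩ : ∃ q : ℝ≥0, expNeg c = q :=
    ⟨_, (ENNReal.coe_toNNReal ((expNeg_le_one c).trans_lt ENNReal.one_lt_top).ne).symm⟩
  have hq1 : q ≤ 1 := by exact_mod_cast hq ▸ expNeg_le_one c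
  -- The exponential series at `r * q`, where `q = expNeg c`; `c = ∞` is the case `q = 0`.
  have hs : HasSum (fun n : ℕ => Real.exp (-r) * r ^ n / (n.factorial : ℝ) * (q : ℝ) ^ n)
      (Real.exp (-(r * (1 - q)))) := by
    convert! (NormedSpace.expSeries_div_hasSum_exp ((r : ℝ) * q)).mul_left (Real.exp (-r)) using 1
    · ext n; rw [mul_pow]; ring
    · rw [← Real.exp_eq_exp_ℝ, ← Real.exp_add]; congr 1; ring
  simp_rw [expNeg_mul_natCast, hq]
  rw [poissonMeasure, lintegral_sum_measure]
  simp_rw [lintegral_smul_measure, lintegral_dirac]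
  have h1 : ∀ n : ℕ, ENNReal.ofReal (Real.exp (-r) * r ^ n / (n.factorial : ℝ)) • (q : ℝ≥0∞) ^ n
      = ENNReal.ofReal (Real.exp (-r) * r ^ n / (n.factorial : ℝ) * (q : ℝ) ^ n) := by
    intro n
    rw [ENNReal.ofReal_mul (by positivity), ENNReal.ofReal_pow q.coe_nonneg, ENNReal.ofReal_coe_nnreal,
      smul_eq_mul]
  simp_rw [h1]
  rw [← ENNReal.ofReal_tsum_of_nonneg (fun n => by positivity) hs.summable, hs.tsum_eq]
  rw [← expNeg_ofReal (mul_nonneg r.coe_nonneg (sub_nonneg.2 (by exact_mod_cast hq1))),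
    ENNReal.ofReal_mul r.coe_nonneg, ENNReal.ofReal_coe_nnreal, ENNReal.ofReal_sub _ q.coe_nonneg,
    ENNReal.ofReal_coe_nnreal, ENNReal.ofReal_one]

theorem lintegral_poissonMeasure_natCast (r : ℝ≥0) :
    ∫⁻ n, (n : ℝ≥0∞) ∂(poissonMeasure r) = r := by
  have hs : HasSum (fun n : ℕ => Real.exp (-r) * r ^ n / (n.factorial : ℝ) * (n : ℝ)) r := by
    rw [← hasSum_nat_add_iff' 1]
    convert! (NormedSpace.expSeries_div_hasSum_exp (r : ℝ)).mul_left (r * Real.exp (-r)) using 1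
    · ext n
      rw [Nat.factorial_succ]
      push_cast
      field_simp
      ring
    · rw [← Real.exp_eq_exp_ℝ, mul_assoc, ← Real.exp_add]; simp
  rw [poissonMeasure, lintegral_sum_measure]
  simp_rw [lintegral_smul_measure, lintegral_dirac]
  have h1 : ∀ n : ℕ, ENNReal.ofReal (Real.exp (-r) * r ^ n / (n.factorial : ℝ)) • (n : ℝ≥0∞)
      = ENNReal.ofReal (Real.exp (-r) * r ^ n / (n.factorial : ℝ) * (n : ℝ)) := by
    intro n
    rw [ENNReal.ofReal_mul (by positivity), ENNReal.ofReal_natCast, smul_eq_mul]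
  simp_rw [h1]
  rw [← ENNReal.ofReal_tsum_of_nonneg (fun n => by positivity) hs.summable, hs.tsum_eq,
    ENNReal.ofReal_coe_nnreal]

theorem toENNReal_pointCount {Ω : Type*} (y : ℕ → Ω → Plane) (B : Set Plane) (ω : Ω) :
    (pointCount y B ω : ℝ≥0∞) = ∑' i, B.indicator 1 (y i ω) := by
  rw [pointCount, ← ENNReal.tsum_set_one, tsum_subtype {i | y i ω ∈ B} (fun _ => (1 : ℝ≥0∞))]
  rfl

/-! ### Laplace functional and intensity of a Poisson process -/

section PointProcess

variable {Ω : Type*} [MeasurableSpace Ω] {μ : Measure Ω} {lam : ℝ} {y : ℕ → Ω → Plane}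

theorem measurable_pointCount (hy : ∀ i, Measurable (y i)) {B : Set Plane}
    (hB : MeasurableSet B) : Measurable (pointCount y B) := by
  have h1 : Measurable fun ω => (pointCount y B ω : ℝ≥0∞) := by
    simp_rw [toENNReal_pointCount]
    exact Measurable.tsum fun i => (measurable_one.indicator hB).comp (hy i)
  refine measurable_to_countable' fun k => ?_
  have : pointCount y B ⁻¹' {k} = (fun ω => (pointCount y B ω : ℝ≥0∞)) ⁻¹' {(k : ℝ≥0∞)} := by
    ext ω; simp
  rw [this]
  exact h1 (measurableSet_singleton _)

theorem IsPoissonProcess.lintegral_pointCount_comp (hy : IsPoissonProcess μ lam y) {B : Set Plane}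
    (hB : MeasurableSet B) (hB' : volume B ≠ ⊤) (F : ℝ≥0∞ → ℝ≥0∞) :
    ∫⁻ ω, F (pointCount y B ω) ∂μ =
      ∫⁻ n, F (n : ℝ≥0∞) ∂(poissonMeasure (lam * volume.real B).toNNReal) := by
  have h := hy.count_law B hB hB'
  have h1 : ∫⁻ ω, F (pointCount y B ω) ∂μ = ∫⁻ k : ℕ∞, F k ∂(μ.map (pointCount y B)) := by
    rw [lintegral_map' (Measurable.of_discrete).aemeasurable h.aemeasurable]
  rw [h1, h.map_eq, lintegral_map' (Measurable.of_discrete).aemeasurable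
    (Measurable.of_discrete).aemeasurable]
  simp

theorem coe_toNNReal_mul_measureReal (lam : ℝ) (hlam : 0 ≤ lam) {B : Set Plane}
    (hB' : volume B ≠ ⊤) :
    (((lam * volume.real B).toNNReal : ℝ≥0) : ℝ≥0∞) = ENNReal.ofReal lam * volume B := by
  rw [← ENNReal.ofReal, ENNReal.ofReal_mul hlam, ofReal_measureReal hB']

theorem IsPoissonProcess.lintegral_expNeg_pointCount (hy : IsPoissonProcess μ lam y)
    (hlam : 0 ≤ lam) {B : Set Plane} (hB : MeasurableSet B) (hB' : volume B ≠ ⊤) (c : ℝ≥0∞) :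
    ∫⁻ ω, expNeg (c * pointCount y B ω) ∂μ =
      expNeg (ENNReal.ofReal lam * ((1 - expNeg c) * volume B)) := by
  rw [hy.lintegral_pointCount_comp hB hB' (fun x => expNeg (c * x)),
    lintegral_expNeg_poissonMeasure, coe_toNNReal_mul_measureReal lam hlam hB', mul_assoc,
    mul_comm (volume B)]

theorem IsPoissonProcess.lintegral_pointCount (hy : IsPoissonProcess μ lam y)
    (hlam : 0 ≤ lam) {B : Set Plane} (hB : MeasurableSet B) (hB' : volume B ≠ ⊤) :
    ∫⁻ ω, (pointCount y B ω : ℝ≥0∞) ∂μ = ENNReal.ofReal lam * volume B := by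
  rw [hy.lintegral_pointCount_comp hB hB' (fun x => x),
    lintegral_poissonMeasure_natCast, coe_toNNReal_mul_measureReal lam hlam hB']

/-- The Laplace functional of a Poisson process at a simple function. -/
theorem IsPoissonProcess.laplace_simpleFunc (hy : IsPoissonProcess μ lam y)
    (hlam : 0 ≤ lam) (f : SimpleFunc Plane ℝ≥0∞) (hf : ∀ c ≠ 0, volume (f ⁻¹' {c}) ≠ ⊤) :
    ∫⁻ ω, expNeg (∑' i, f (y i ω)) ∂μ =
      expNeg (ENNReal.ofReal lam * ∫⁻ x, (1 - expNeg (f x))) := by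
  classical
  -- The level set of `0` may have infinite area, but it contributes nothing to either side.
  set s := f.range.erase 0 with hs
  let e := s.equivFin
  let c : Fin s.card → ℝ≥0∞ := fun k => (e.symm k : ℝ≥0∞)
  let B : Fin s.card → Set Plane := fun k => f ⁻¹' {c k}
  have hc : ∀ k, c k ≠ 0 := fun k => (Finset.mem_erase.1 (e.symm k).2).1
  have hBm : ∀ k, MeasurableSet (B k) := fun k => f.measurableSet_preimage _
  have hBf : ∀ k, volume (B k) ≠ ⊤ := fun k => hf _ (hc k)
  have hinj : Function.Injective c := Subtype.val_injective.comp e.symm.injective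
  have hdisj : Pairwise (fun k l => Disjoint (B k) (B l)) := fun k l hkl =>
    Disjoint.preimage f (by simpa using fun h => hkl (hinj h))
  have hsum : ∀ φ : ℝ≥0∞ → ℝ≥0∞, ∑ k, φ (c k) = ∑ x ∈ s, φ x := fun φ => by
    rw [← Finset.sum_coe_sort s]
    exact Equiv.sum_comp e.symm (fun x : s => φ x)
  have hpt : ∀ x, f x = ∑ k, c k * (B k).indicator 1 x := fun x => by
    have : ∑ k, c k * (B k).indicator 1 x = ∑ a ∈ s, a * (f ⁻¹' {a}).indicator 1 x :=
      hsum fun a => a * (f ⁻¹' {a}).indicator 1 x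
    rw [this]
    by_cases h0 : f x = 0
    · rw [h0, Finset.sum_eq_zero]
      intro a ha
      have : a ≠ 0 := (Finset.mem_erase.1 ha).1
      simp [Set.indicator, h0, this.symm]
    · rw [Finset.sum_eq_single (f x)]
      · simp
      · intro a _ ha; simp [Set.indicator, ha.symm]
      · intro h; exact absurd (Finset.mem_erase.2 ⟨h0, f.mem_range_self x⟩) h
  -- The sum over points is `∑ c k * N(B k)`, so its exponential splits into independent factors.
  have hL : ∀ ω, expNeg (∑' i, f (y i ω)) = ∏ k, expNeg (c k * pointCount y (B k) ω) := fun ω => by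
    rw [← expNeg_sum]
    congr 1
    simp_rw [hpt]
    rw [Summable.tsum_finsetSum fun _ _ => ENNReal.summable]
    simp_rw [ENNReal.tsum_mul_left, toENNReal_pointCount]
  have hR : ∫⁻ x, (1 - expNeg (f x)) = ∑ k, (1 - expNeg (c k)) * volume (B k) := by
    have h1 := SimpleFunc.map_lintegral (μ := volume) (fun a => 1 - expNeg a) f
    rw [← SimpleFunc.lintegral_eq_lintegral] at h1
    have h2 : ∑ k, (1 - expNeg (c k)) * volume (B k)
      = ∑ a ∈ s, (1 - expNeg a) * volume (f ⁻¹' {a}) :=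
      hsum fun a => (1 - expNeg a) * volume (f ⁻¹' {a})
    rw [h2]
    refine h1.trans ?_
    symm
    apply Finset.sum_subset (Finset.erase_subset _ _)
    intro a ha hna
    have : a = 0 := by by_contra h; exact hna (Finset.mem_erase.2 ⟨h, ha⟩)
    simp [this, expNeg_zero]
  simp_rw [hL]
  rw [lintegral_prod_eq_prod_lintegral_of_indepFun Finset.univ
    (fun k ω => expNeg (c k * pointCount y (B k) ω))]
  · simp_rw [fun k => hy.lintegral_expNeg_pointCount hlam (hBm k) (hBf k) (c k)]
    rw [← expNeg_sum, ← Finset.mul_sum, hR]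
  · exact (hy.count_indep _ B hBm hBf hdisj).comp (fun k (n : ℕ∞) => expNeg (c k * n))
      (fun k => Measurable.of_discrete)
  · intro k
    exact Measurable.comp (g := fun n : ℕ∞ => expNeg (c k * n)) Measurable.of_discrete
      (measurable_pointCount hy.measurable (hBm k))

/-- The Laplace functional of a Poisson process. -/
theorem IsPoissonProcess.laplace (hy : IsPoissonProcess μ lam y)
    (hlam : 0 ≤ lam) [IsProbabilityMeasure μ] {f : Plane → ℝ≥0∞} (hf : Measurable f) :
    ∫⁻ ω, expNeg (∑' i, f (y i ω)) ∂μ =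
      expNeg (ENNReal.ofReal lam * ∫⁻ x, (1 - expNeg (f x))) := by
  -- Restricting to balls gives the nonzero level sets finite area and keeps the approximation
  -- increasing.
  let F : ℕ → SimpleFunc Plane ℝ≥0∞ := fun n =>
    (SimpleFunc.eapprox f n).restrict (Metric.closedBall 0 n)
  have hFapp : ∀ n x, F n x = (Metric.closedBall (0 : Plane) n).indicator
      (SimpleFunc.eapprox f n) x := fun n x =>
    SimpleFunc.restrict_apply _ Metric.isClosed_closedBall.measurableSet x
  have hmono : ∀ x, Monotone fun n => F n x := fun x m n hmn => by
    simp only [hFapp]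
    have hmn' : (m : ℝ) ≤ n := by exact_mod_cast hmn
    refine (Set.indicator_le_indicator_of_subset
      (Metric.closedBall_subset_closedBall hmn') (fun _ => zero_le) x).trans ?_
    exact Set.indicator_le_indicator (SimpleFunc.monotone_eapprox f hmn x)
  have hlim : ∀ x, Tendsto (fun n => F n x) atTop (𝓝 (f x)) := fun x => by
    refine (SimpleFunc.tendsto_eapprox hf x).congr' ?_
    filter_upwards [eventually_ge_atTop ⌈‖x‖⌉₊] with n hn
    rw [hFapp, Set.indicator_of_mem]
    simpa using (Nat.le_ceil _).trans (Nat.cast_le.2 hn)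
  have hfin : ∀ n, ∀ c ≠ 0, volume (F n ⁻¹' {c}) ≠ ⊤ := fun n c hc => by
    refine ne_top_of_le_ne_top (isCompact_closedBall (0 : Plane) n).measure_ne_top
      (measure_mono ?_)
    intro x hx
    by_contra h
    rw [mem_preimage, hFapp, Set.indicator_of_notMem h] at hx
    exact hc hx.symm
  have hsum : ∀ ω, Tendsto (fun n => ∑' i, F n (y i ω)) atTop (𝓝 (∑' i, f (y i ω))) := fun ω => by
    -- Monotone convergence for the counting measure.
    have h1 : ∑' i, f (y i ω) = ⨆ n, ∑' i, F n (y i ω) := by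
      have h2 : ∀ i, f (y i ω) = ⨆ n, F n (y i ω) := fun i =>
        tendsto_nhds_unique (hlim (y i ω)) (tendsto_atTop_iSup (hmono _))
      simp_rw [h2, ← lintegral_count]
      rw [lintegral_iSup (fun n => measurable_from_top)]
      exact fun m n hmn i => hmono _ hmn
    rw [h1]
    exact tendsto_atTop_iSup fun m n hmn => ENNReal.tsum_le_tsum fun i => hmono _ hmn
  have hlhs : Tendsto (fun n => ∫⁻ ω, expNeg (∑' i, F n (y i ω)) ∂μ) atTop
      (𝓝 (∫⁻ ω, expNeg (∑' i, f (y i ω)) ∂μ)) := by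
    refine tendsto_lintegral_of_dominated_convergence (fun _ => 1) ?_ ?_ ?_ ?_
    · intro n
      exact measurable_expNeg.comp (Measurable.tsum fun i =>
        (F n).measurable.comp (hy.measurable i))
    · exact fun n => ae_of_all _ fun ω => expNeg_le_one _
    · simp
    · exact ae_of_all _ fun ω => (continuous_expNeg.tendsto _).comp (hsum ω)
  have hrhs : Tendsto (fun n => ∫⁻ x, (1 - expNeg (F n x))) atTop
      (𝓝 (∫⁻ x, (1 - expNeg (f x)))) := by
    refine lintegral_tendsto_of_tendsto_of_monotone ?_ ?_ ?_
    · exact fun n => (measurable_const.sub (measurable_expNeg.comp (F n).measurable)).aemeasurable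
    · exact ae_of_all _ fun x m n hmn => tsub_le_tsub_left (antitone_expNeg (hmono x hmn)) _
    · exact ae_of_all _ fun x => ENNReal.Tendsto.sub tendsto_const_nhds
        ((continuous_expNeg.tendsto _).comp (hlim x)) (Or.inl ENNReal.one_ne_top)
  refine tendsto_nhds_unique hlhs ?_
  simp_rw [fun n => hy.laplace_simpleFunc hlam (F n) (hfin n)]
  exact (continuous_expNeg.tendsto _).comp
    (ENNReal.Tendsto.const_mul hrhs (Or.inr ENNReal.ofReal_ne_top))

/-- The intensity measure of a Poisson process of density `lam` is `lam` times the area. -/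
theorem IsPoissonProcess.sum_map (hy : IsPoissonProcess μ lam y) (hlam : 0 ≤ lam) :
    Measure.sum (fun i => μ.map (y i)) = ENNReal.ofReal lam • volume := by
  have key : ∀ B : Set Plane, MeasurableSet B → volume B ≠ ⊤ →
      Measure.sum (fun i => μ.map (y i)) B = ENNReal.ofReal lam * volume B := by
    intro B hB hB'
    rw [← hy.lintegral_pointCount hlam hB hB', Measure.sum_apply _ hB]
    simp_rw [toENNReal_pointCount]
    rw [lintegral_tsum (f := fun i ω => B.indicator 1 (y i ω))
      fun i => ((measurable_one.indicator hB).comp (hy.measurable i)).aemeasurable]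
    refine tsum_congr fun i => ?_
    rw [← lintegral_indicator_one hB, lintegral_map (measurable_one.indicator hB) (hy.measurable i)]
  refine Measure.ext_of_iUnion_eq_univ (s := fun n : ℕ => Metric.closedBall (0 : Plane) n)
    (Metric.iUnion_closedBall_nat 0) fun n => ?_
  ext B hB
  rw [Measure.restrict_apply hB, Measure.restrict_apply hB, Measure.smul_apply, smul_eq_mul]
  refine key _ (hB.inter Metric.isClosed_closedBall.measurableSet) ?_
  exact measure_ne_top_of_subset inter_subset_right
    (isCompact_closedBall (0 : Plane) n).measure_ne_top

/-- Campbell's formula: integration against the intensity measure. -/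
theorem IsPoissonProcess.tsum_lintegral (hy : IsPoissonProcess μ lam y) (hlam : 0 ≤ lam)
    {f : Plane → ℝ≥0∞} (hf : Measurable f) :
    ∑' i, ∫⁻ ω, f (y i ω) ∂μ = ENNReal.ofReal lam * ∫⁻ x, f x := by
  simp_rw [← lintegral_map hf (hy.measurable _)]
  rw [← lintegral_sum_measure, hy.sum_map hlam, lintegral_smul_measure, smul_eq_mul]

/-- A singleton is null for the intensity measure. Used at the origin, where the gain degenerates.
-/
theorem IsPoissonProcess.ae_ne (hy : IsPoissonProcess μ lam y) (hlam : 0 ≤ lam) (a : Plane) :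
    ∀ᵐ ω ∂μ, ∀ i, y i ω ≠ a := by
  have h : Measure.sum (fun i => μ.map (y i)) {a} = 0 := by
    rw [hy.sum_map hlam, Measure.smul_apply, measure_singleton, smul_zero]
  rw [Measure.sum_apply _ (measurableSet_singleton a), ENNReal.tsum_eq_zero] at h
  refine ae_all_iff.2 fun i => ?_
  have := h i
  rw [Measure.map_apply (hy.measurable i) (measurableSet_singleton a)] at this
  rw [ae_iff]
  simpa [preimage] using this

end PointProcess

/-! ### Exponential tails and their integral over the plane -/

theorem expMeasure_Iic {s : ℝ} (hs : 0 ≤ s) :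
    expMeasure 1 (Iic s) = 1 - ENNReal.ofReal (Real.exp (-s)) := by
  have := isProbabilityMeasure_expMeasure one_pos
  have h := cdf_expMeasure_eq one_pos s
  rw [if_pos hs, one_mul, cdf_eq_real] at h
  rw [← ENNReal.ofReal_one, ← ENNReal.ofReal_sub _ (Real.exp_pos _).le, ← h, ofReal_measureReal]

theorem expMeasure_Ioi {s : ℝ} (hs : 0 ≤ s) :
    expMeasure 1 (Ioi s) = ENNReal.ofReal (Real.exp (-s)) := by
  have := isProbabilityMeasure_expMeasure one_pos
  rw [← compl_Iic, prob_compl_eq_one_sub measurableSet_Iic, expMeasure_Iic hs]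
  refine ENNReal.sub_sub_cancel ENNReal.one_ne_top ?_
  rw [ENNReal.ofReal_le_one, Real.exp_le_one_iff]; linarith

theorem expMeasure_Ici {s : ℝ} (hs : 0 ≤ s) :
    expMeasure 1 (Ici s) = ENNReal.ofReal (Real.exp (-s)) := by
  rw [← expMeasure_Ioi hs]
  have : expMeasure 1 ≪ volume := withDensity_absolutelyContinuous _ _
  exact measure_congr (this.ae_eq Ioi_ae_eq_Ici).symm

theorem measurable_expMeasure_Iic : Measurable fun s : ℝ => expMeasure 1 (Iic s) :=
  Monotone.measurable fun _ _ h => measure_mono (Iic_subset_Iic.2 h)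

theorem measurable_expMeasure_Ioi : Measurable fun s : ℝ => expMeasure 1 (Ioi s) :=
  Antitone.measurable fun _ _ h => measure_mono (Ioi_subset_Ioi h)

theorem lintegral_exp_neg_mul_norm_rpow {p b : ℝ} (hp : 1 ≤ p) (hb : 0 < b) :
    ∫⁻ x : Plane, ENNReal.ofReal (Real.exp (-(b * ‖x‖ ^ p))) =
      ENNReal.ofReal (Real.pi * b ^ (-2 / p) * Real.Gamma (2 / p + 1)) := by
  have h := Complex.integral_exp_neg_mul_rpow hp hb
  have hpos : 0 < Real.pi * b ^ (-2 / p) * Real.Gamma (2 / p + 1) := by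
    have := Real.Gamma_pos_of_pos (s := 2 / p + 1) (by positivity)
    positivity
  -- A non-integrable function has integral `0` by convention, but the known value is positive.
  have hint : Integrable fun x : ℂ => Real.exp (-b * ‖x‖ ^ p) := by
    by_contra hn
    rw [integral_undef hn] at h
    exact hpos.ne h
  rw [← h, ofReal_integral_eq_lintegral_ofReal hint (ae_of_all _ fun x => (Real.exp_pos _).le)]
  rw [← Complex.orthonormalBasisOneI.measurePreserving_repr.lintegral_comp]
  · refine lintegral_congr fun x => ?_
    rw [LinearIsometryEquiv.norm_map, neg_mul]
  · fun_prop

theorem eveGain_le_iff {Ω : Type*} {y : ℕ → Ω → Plane} {g : ℕ → Ω → ℝ} {α t : ℝ} {i : ℕ} {ω : Ω}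
    (hy : y i ω ≠ 0) :
    eveGain α y g i ω ≤ t ↔ g i ω ≤ t * ‖y i ω‖ ^ α := by
  have : 0 < ‖y i ω‖ ^ α := Real.rpow_pos_of_pos (norm_pos_iff.2 hy) _
  rw [eveGain, Real.rpow_neg (norm_nonneg _), ← div_eq_mul_inv, div_le_iff₀ this]

/-! ### The strongest eavesdropper -/

section Network

variable {Ω : Type*} [MeasurableSpace Ω] {μ : Measure Ω} {lam : ℝ}
  {h : Ω → ℝ} {y : ℕ → Ω → Plane} {g : ℕ → Ω → ℝ}

/-- Fubini: independence of `g` and `y` allows the locations to be frozen, and then mutual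
independence of the `g i` gives the product. -/
theorem IsFadingNetwork.measure_finset_le [IsProbabilityMeasure μ]
    (hn : IsFadingNetwork μ lam h y g) {φ : Plane → ℝ}
    (hφ : Measurable φ) (s : Finset ℕ) :
    μ {ω | ∀ i ∈ s, g i ω ≤ φ (y i ω)} =
      ∫⁻ ω, ∏ i ∈ s, expMeasure 1 (Iic (φ (y i ω))) ∂μ := by
  have hg : Measurable fun ω i => g i ω := measurable_pi_lambda _ hn.measurable_g
  have hy : Measurable fun ω i => y i ω := measurable_pi_lambda _ hn.poisson.measurable
  let S : Set ((ℕ → ℝ) × (ℕ → Plane)) := {p | ∀ i ∈ s, p.1 i ≤ φ (p.2 i)}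
  have hS : MeasurableSet S := by
    have : S = ⋂ i ∈ s, {p : (ℕ → ℝ) × (ℕ → Plane) | p.1 i ≤ φ (p.2 i)} := by
      ext p; simp [S]
    rw [this]
    refine Finset.measurableSet_biInter _ fun i _ => measurableSet_le (by fun_prop) ?_
    exact hφ.comp ((measurable_pi_apply i).comp measurable_snd)
  have hprod := (indepFun_iff_map_prod_eq_prod_map_map hg.aemeasurable hy.aemeasurable).1
    hn.indep_g_y
  have := Measure.isProbabilityMeasure_map (μ := μ) hg.aemeasurable
  have := Measure.isProbabilityMeasure_map (μ := μ) hy.aemeasurable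
  calc μ {ω | ∀ i ∈ s, g i ω ≤ φ (y i ω)}
      = (μ.map fun ω => ((fun i => g i ω), (fun i => y i ω))) S := by
        rw [Measure.map_apply (hg.prodMk hy) hS]; rfl
    _ = ∫⁻ z, (μ.map fun ω i => g i ω) ((fun x => (x, z)) ⁻¹' S) ∂(μ.map fun ω i => y i ω) := by
        rw [hprod, Measure.prod_apply_symm hS]
    _ = ∫⁻ ω, (μ.map fun ω i => g i ω) ((fun x => (x, fun i => y i ω)) ⁻¹' S) ∂μ := by
        rw [lintegral_map (measurable_measure_prodMk_right hS) hy]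
    _ = _ := by
        refine lintegral_congr fun ω => ?_
        rw [Measure.map_apply hg (hS.preimage (by fun_prop))]
        have h1 : (fun ω i => g i ω) ⁻¹' ((fun x => (x, fun i => y i ω)) ⁻¹' S)
            = ⋂ i ∈ s, g i ⁻¹' Iic (φ (y i ω)) := by
          ext ω'; simp [S]
        rw [h1, hn.indep_g.measure_inter_preimage_eq_mul s fun i _ => measurableSet_Iic]
        refine Finset.prod_congr rfl fun i _ => ?_
        rw [← (hn.law_g i).map_eq, Measure.map_apply (hn.measurable_g i) measurableSet_Iic]

/-- The probability that no fading coefficient exceeds the level prescribed by the location of its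
eavesdropper. -/
theorem IsFadingNetwork.measure_forall_le [IsProbabilityMeasure μ] (hlam : 0 ≤ lam)
    (hn : IsFadingNetwork μ lam h y g) {φ : Plane → ℝ} (hφ : Measurable φ) :
    μ {ω | ∀ i, g i ω ≤ φ (y i ω)} =
      expNeg (ENNReal.ofReal lam * ∫⁻ x, expMeasure 1 (Ioi (φ x))) := by
  have := isProbabilityMeasure_expMeasure one_pos
  let F : Plane → ℝ≥0∞ := fun x => expMeasure 1 (Iic (φ x))
  have hF : Measurable F := measurable_expMeasure_Iic.comp hφ
  let f : Plane → ℝ≥0∞ := fun x => (-(ENNReal.log (F x))).toENNReal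
  have hf : Measurable f := measurable_ereal_toENNReal.comp hF.ennreal_log.neg
  have hfF : ∀ x, expNeg (f x) = F x := fun x => expNeg_neg_log prob_le_one
  have hms : ∀ n : ℕ, MeasurableSet {ω | ∀ i ∈ Finset.range n, g i ω ≤ φ (y i ω)} := fun n => by
    have : {ω | ∀ i ∈ Finset.range n, g i ω ≤ φ (y i ω)}
        = ⋂ i ∈ Finset.range n, {ω | g i ω ≤ φ (y i ω)} := by ext; simp
    rw [this]
    exact Finset.measurableSet_biInter _ fun i _ =>
      measurableSet_le (hn.measurable_g i) (hφ.comp (hn.poisson.measurable i))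
  have h1 : Tendsto (fun n : ℕ => μ {ω | ∀ i ∈ Finset.range n, g i ω ≤ φ (y i ω)}) atTop
      (𝓝 (μ {ω | ∀ i, g i ω ≤ φ (y i ω)})) := by
    have heq : {ω | ∀ i, g i ω ≤ φ (y i ω)}
        = ⋂ n : ℕ, {ω | ∀ i ∈ Finset.range n, g i ω ≤ φ (y i ω)} := by
      ext ω
      simp only [mem_ofPred_eq, mem_iInter, Finset.mem_range]
      exact ⟨fun H n i _ => H i, fun H i => H (i + 1) i i.lt_succ_self⟩
    rw [heq]
    refine tendsto_measure_iInter_atTop (fun n => (hms n).nullMeasurableSet) ?_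
      ⟨0, measure_ne_top _ _⟩
    intro m n hmn ω hω i hi
    exact hω i (Finset.range_subset_range.2 hmn hi)
  have h2 : Tendsto (fun n : ℕ => ∫⁻ ω, expNeg (∑ i ∈ Finset.range n, f (y i ω)) ∂μ) atTop
      (𝓝 (∫⁻ ω, expNeg (∑' i, f (y i ω)) ∂μ)) := by
    refine tendsto_lintegral_of_dominated_convergence (fun _ => 1) ?_ ?_ ?_ ?_
    · exact fun n => measurable_expNeg.comp (Finset.measurable_fun_sum _ fun i _ =>
        hf.comp (hn.poisson.measurable i))
    · exact fun n => ae_of_all _ fun ω => expNeg_le_one _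
    · simp
    · exact ae_of_all _ fun ω => (continuous_expNeg.tendsto _).comp
        (ENNReal.tendsto_nat_tsum _)
  refine tendsto_nhds_unique h1 ?_
  have h3 : ∫⁻ x, expMeasure 1 (Ioi (φ x)) = ∫⁻ x, (1 - expNeg (f x)) := by
    refine lintegral_congr fun x => ?_
    rw [hfF, ← compl_Iic, prob_compl_eq_one_sub measurableSet_Iic]
  rw [h3, ← hn.poisson.laplace hlam hf]
  refine h2.congr fun n => ?_
  rw [hn.measure_finset_le hφ]
  simp_rw [expNeg_sum, hfF, F]

/-- The expected number of exceedances, by Campbell's formula; its finiteness feeds Borel–Cantelli.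
-/
theorem IsFadingNetwork.tsum_measure_lt [IsProbabilityMeasure μ] (hlam : 0 ≤ lam)
    (hn : IsFadingNetwork μ lam h y g) {φ : Plane → ℝ} (hφ : Measurable φ) :
    ∑' i, μ {ω | φ (y i ω) < g i ω} =
      ENNReal.ofReal lam * ∫⁻ x, expMeasure 1 (Ioi (φ x)) := by
  have := isProbabilityMeasure_expMeasure one_pos
  rw [← hn.poisson.tsum_lintegral hlam (f := fun x => expMeasure 1 (Ioi (φ x)))
    (measurable_expMeasure_Ioi.comp hφ)]
  refine tsum_congr fun i => ?_
  have h1 := hn.measure_finset_le hφ {i}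
  simp only [Finset.mem_singleton, forall_eq, Finset.prod_singleton] at h1
  have h2 : {ω | φ (y i ω) < g i ω} = {ω | g i ω ≤ φ (y i ω)}ᶜ := by ext; simp
  have hm : Measurable fun ω => expMeasure 1 (Iic (φ (y i ω))) :=
    measurable_expMeasure_Iic.comp (hφ.comp (hn.poisson.measurable i))
  have hms : MeasurableSet {ω | g i ω ≤ φ (y i ω)} :=
    measurableSet_le (hn.measurable_g i) (hφ.comp (hn.poisson.measurable i))
  rw [h2, prob_compl_eq_one_sub hms, h1]
  simp_rw [← compl_Iic, prob_compl_eq_one_sub measurableSet_Iic]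
  rw [lintegral_sub hm (h1 ▸ measure_ne_top _ _) (ae_of_all _ fun _ => prob_le_one)]
  simp

theorem measurable_mul_norm_rpow (t α : ℝ) : Measurable fun x : Plane => t * ‖x‖ ^ α := by
  fun_prop

theorem lintegral_expMeasure_Ioi {t α : ℝ} (hα : 1 ≤ α) (ht : 0 < t) :
    ∫⁻ x : Plane, expMeasure 1 (Ioi (t * ‖x‖ ^ α)) =
      ENNReal.ofReal (Real.pi * t ^ (-2 / α) * Real.Gamma (2 / α + 1)) := by
  rw [← lintegral_exp_neg_mul_norm_rpow hα ht]
  exact lintegral_congr fun x => expMeasure_Ioi (by positivity)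

theorem IsFadingNetwork.ae_pos (hn : IsFadingNetwork μ lam h y g) : ∀ᵐ ω ∂μ, ∀ i, 0 < g i ω := by
  have := isProbabilityMeasure_expMeasure one_pos
  refine ae_all_iff.2 fun i => ((hn.law_g i).ae_iff (p := fun x => 0 < x) ?_).2 ?_
  · exact measurableSet_setOfPred.1 measurableSet_Ioi
  · rw [ae_iff]
    have : {x : ℝ | ¬ 0 < x} = Iic 0 := by ext; simp
    rw [this, expMeasure_Iic le_rfl]; simp

theorem IsFadingNetwork.ae_eveGain_pos (hn : IsFadingNetwork μ lam h y g) (hlam : 0 ≤ lam)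
    (α : ℝ) : ∀ᵐ ω ∂μ, ∀ i, 0 < eveGain α y g i ω := by
  filter_upwards [hn.ae_pos, hn.poisson.ae_ne hlam 0] with ω hg hy i
  exact mul_pos (hg i) (Real.rpow_pos_of_pos (norm_pos_iff.2 (hy i)) _)

theorem IsFadingNetwork.ae_exists_isStrongest [IsProbabilityMeasure μ]
    (hn : IsFadingNetwork μ lam h y g) (hlam : 0 ≤ lam) {α : ℝ} (hα : 1 ≤ α) :
    ∀ᵐ ω ∂μ, ∃ i, IsStrongest α y g ω i := by
  -- Borel–Cantelli at the countably many levels `1 / (n + 1)`, so that one null set serves them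
  -- all.
  have hBC : ∀ᵐ ω ∂μ, ∀ n : ℕ, ∀ᶠ i in atTop, g i ω ≤ 1 / (n + 1 : ℝ) * ‖y i ω‖ ^ α := by
    refine ae_all_iff.2 fun n => ?_
    have h1 := hn.tsum_measure_lt hlam (measurable_mul_norm_rpow (1 / (n + 1 : ℝ)) α)
    rw [lintegral_expMeasure_Ioi hα (by positivity)] at h1
    have h2 := ae_eventually_notMem
      (h1 ▸ ENNReal.mul_ne_top ENNReal.ofReal_ne_top ENNReal.ofReal_ne_top)
    filter_upwards [h2] with ω hω
    filter_upwards [hω] with i hi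
    simpa using hi
  filter_upwards [hBC, hn.ae_eveGain_pos hlam α, hn.poisson.ae_ne hlam 0] with ω hω hpos hy
  -- A level below the gain of index `0`: the gains above it form a finite nonempty family, whose
  -- maximum is global.
  obtain ⟨n, hlt⟩ := exists_nat_one_div_lt (hpos 0)
  have hfin : {i | 1 / (n + 1 : ℝ) < eveGain α y g i ω}.Finite := by
    have := hω n
    rw [← Nat.cofinite_eq_atTop, Filter.eventually_cofinite] at this
    refine this.subset fun i hi => ?_
    simp only [mem_ofPred_eq] at hi ⊢
    rwa [← eveGain_le_iff (hy i), not_le]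
  obtain ⟨i, hi, hmax⟩ := Set.exists_max_image _ (fun i => eveGain α y g i ω) hfin ⟨0, hlt⟩
  refine ⟨i, fun j => ?_⟩
  by_cases hj : 1 / (n + 1 : ℝ) < eveGain α y g j ω
  · exact hmax j hj
  · exact (not_lt.1 hj).trans (le_of_lt hi)

/-- The distribution function of the gain of the strongest eavesdropper. -/
theorem IsFadingNetwork.measureReal_strongest_le [IsProbabilityMeasure μ]
    (hn : IsFadingNetwork μ lam h y g) (hlam : 0 ≤ lam) {α t : ℝ} (hα : 1 ≤ α) (ht : 0 < t) :
    μ.real {ω | eveGain α y g (strongest α y g ω) ω ≤ t} =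
      Real.exp (-(lam * (Real.pi * t ^ (-2 / α) * Real.Gamma (2 / α + 1)))) := by
  have hG := Real.Gamma_pos_of_pos (s := 2 / α + 1) (by positivity)
  have h1 : {ω | eveGain α y g (strongest α y g ω) ω ≤ t} =ᵐ[μ]
      {ω | ∀ i, g i ω ≤ t * ‖y i ω‖ ^ α} := by
    filter_upwards [hn.ae_exists_isStrongest hlam hα, hn.poisson.ae_ne hlam 0] with ω hs hy
    have hst : IsStrongest α y g ω (strongest α y g ω) := Classical.epsilon_spec hs
    refine propext ?_
    change eveGain α y g (strongest α y g ω) ω ≤ t ↔ ∀ i, g i ω ≤ t * ‖y i ω‖ ^ α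
    refine ⟨fun H i => (eveGain_le_iff (hy i)).1 ((hst i).trans H), fun H => ?_⟩
    exact (eveGain_le_iff (hy _)).2 (H _)
  rw [measureReal_congr h1, measureReal_def,
    hn.measure_forall_le hlam (measurable_mul_norm_rpow t α), lintegral_expMeasure_Ioi hα ht,
    ← ENNReal.ofReal_mul hlam, expNeg_ofReal (by positivity),
    ENNReal.toReal_ofReal (Real.exp_pos _).le]

end Network

/-! ### Coverage probability -/

/-- Treated apart because the formula `exp (-c / γ)` would give `1` at `γ = 0`, with division by
zero equal to `0`. -/
theorem covProb_zero {Ω : Type*} [MeasurableSpace Ω] (μ : Measure Ω) (α Pt d σP : ℝ) {βt : ℝ}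
    (hβt : 0 < βt) (h : Ω → ℝ) : covProb μ α Pt d σP βt h 0 = 0 := by
  have : {ω | βt ≤ snrP α Pt d σP h 0 ω} = ∅ := by
    ext ω; simp [snrP, hβt]
  rw [covProb, this, measureReal_empty]

section

variable {Ω : Type*} [MeasurableSpace Ω] {μ : Measure Ω} {α lam Pt d σP σS βt βe ε : ℝ}
  {h : Ω → ℝ} {y : ℕ → Ω → Plane} {g : ℕ → Ω → ℝ}

theorem IsFadingNetwork.covProb_eq (hn : IsFadingNetwork μ lam h y g) (hPt : 0 < Pt) (hd : 0 < d)
    (hσP : 0 < σP) (hβt : 0 < βt) {γ : ℝ} (hγ : 0 < γ) :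
    covProb μ α Pt d σP βt h γ = Real.exp (-(βt * σP ^ 2 / (Pt * d ^ (-α)) / γ)) := by
  have hdα : 0 < d ^ (-α) := Real.rpow_pos_of_pos hd _
  have h1 : {ω | βt ≤ snrP α Pt d σP h γ ω} =
      {ω | h ω ∈ Ici (βt * σP ^ 2 / (Pt * d ^ (-α)) / γ)} := by
    ext ω
    simp only [mem_ofPred_eq, mem_Ici, snrP]
    rw [le_div_iff₀ (by positivity), div_div, div_le_iff₀ (by positivity)]
    ring_nf
  rw [covProb, h1, measureReal_def, hn.law_h.measure_eq (p := fun x => x ∈ Ici _) measurableSet_Ici]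
  change (expMeasure 1 (Ici _)).toReal = _
  rw [expMeasure_Ici (by positivity), ENNReal.toReal_ofReal (Real.exp_pos _).le]

theorem IsFadingNetwork.strictMonoOn_covProb (hn : IsFadingNetwork μ lam h y g) (hPt : 0 < Pt)
    (hd : 0 < d) (hσP : 0 < σP) (hβt : 0 < βt) :
    StrictMonoOn (covProb μ α Pt d σP βt h) (Ici 0) := by
  intro a ha b _ hab
  have hdα : 0 < d ^ (-α) := Real.rpow_pos_of_pos hd _
  rcases (mem_Ici.1 ha).eq_or_lt with rfl | ha'
  · rw [covProb_zero μ α Pt d σP hβt, hn.covProb_eq hPt hd hσP hβt hab]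
    exact Real.exp_pos _
  · rw [hn.covProb_eq hPt hd hσP hβt ha', hn.covProb_eq hPt hd hσP hβt (ha'.trans hab)]
    exact Real.exp_lt_exp.2 (neg_lt_neg (div_lt_div_of_pos_left (by positivity) ha' hab))

/-! ### The secrecy constraint as a bound on the power fraction -/

/-- For a positive gain `G` the secrecy constraint is linear in `G`. -/
theorem secrecy_snr_le_iff (hPt : 0 < Pt) (hσS : 0 < σS) {γ G : ℝ} (hγ : γ ≤ 1) (hG : 0 < G) :
    γ * Pt * G / ((1 - γ) * Pt * G + σS ^ 2) ≤ βe ↔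
      Pt * (γ * (1 + βe) - βe) * G ≤ βe * σS ^ 2 := by
  have h1 : 0 ≤ 1 - γ := sub_nonneg.2 hγ
  rw [div_le_iff₀ (by positivity)]
  constructor <;> intro H <;> linarith

theorem IsFadingNetwork.secProb_eq [IsProbabilityMeasure μ] (hn : IsFadingNetwork μ lam h y g)
    (hlam : 0 < lam) (hPt : 0 < Pt) (hσS : 0 < σS) {γ : ℝ} (hγ : γ ≤ 1) :
    secProb μ α Pt σS βe y g γ =
      μ.real {ω | Pt * (γ * (1 + βe) - βe) * eveGain α y g (strongest α y g ω) ω ≤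
        βe * σS ^ 2} := by
  refine measureReal_congr ?_
  filter_upwards [hn.ae_eveGain_pos hlam.le α] with ω hω
  exact propext (secrecy_snr_le_iff hPt hσS hγ (hω _))

theorem IsFadingNetwork.le_secProb_iff [IsProbabilityMeasure μ]
    (hn : IsFadingNetwork μ lam h y g) (hα : 1 ≤ α) (hlam : 0 < lam) (hPt : 0 < Pt) (hσS : 0 < σS)
    (hβe : 0 < βe) (hε : 0 < ε) (hε1 : ε ≤ 1) {γ : ℝ} (hγ : γ ≤ 1) :
    ε ≤ secProb μ α Pt σS βe y g γ ↔
      γ ≤ βe / (1 + βe) * (1 + σS ^ 2 / Pt *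
        (α * Real.log (1 / ε) / (2 * Real.pi * lam * Real.Gamma (2 / α))) ^ (α / 2)) := by
  have hα0 : 0 < α := one_pos.trans_le hα
  have hG := Real.Gamma_pos_of_pos (s := 2 / α) (by positivity)
  have hlog : 0 ≤ Real.log (1 / ε) := Real.log_nonneg (by rw [le_div_iff₀ hε]; linarith)
  set A := α * Real.log (1 / ε) / (2 * Real.pi * lam * Real.Gamma (2 / α)) with hA
  have hA0 : 0 ≤ A := by positivity
  have hAα : 0 ≤ A ^ (α / 2) := Real.rpow_nonneg hA0 _
  have hγ0 : γ ≤ βe / (1 + βe) * (1 + σS ^ 2 / Pt * A ^ (α / 2)) ↔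
      γ * (1 + βe) - βe ≤ βe * σS ^ 2 / Pt * A ^ (α / 2) := by
    rw [div_mul_eq_mul_div, le_div_iff₀ (by positivity), sub_le_iff_le_add]
    have : βe * (1 + σS ^ 2 / Pt * A ^ (α / 2)) = βe * σS ^ 2 / Pt * A ^ (α / 2) + βe := by ring
    rw [this]
  rw [hγ0, hn.secProb_eq hlam hPt hσS hγ]
  set u := γ * (1 + βe) - βe with hu
  -- For `u ≤ 0` artificial noise alone keeps the SNR below `βe`, whatever the gain.
  rcases le_or_gt u 0 with hu0 | hu0
  · have h1 : {ω | Pt * u * eveGain α y g (strongest α y g ω) ω ≤ βe * σS ^ 2} =ᵐ[μ] univ := by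
      filter_upwards [hn.ae_eveGain_pos hlam.le α] with ω hω
      refine propext ⟨fun _ => trivial, fun _ => ?_⟩
      refine le_trans ?_ (show (0 : ℝ) ≤ βe * σS ^ 2 by positivity)
      exact mul_nonpos_of_nonpos_of_nonneg (mul_nonpos_of_nonneg_of_nonpos hPt.le hu0) (hω _).le
    rw [measureReal_congr h1, probReal_univ]
    exact iff_of_true hε1 (hu0.trans (by positivity))
  · set t := βe * σS ^ 2 / (Pt * u) with ht
    have ht0 : 0 < t := by positivity
    have h1 : {ω | Pt * u * eveGain α y g (strongest α y g ω) ω ≤ βe * σS ^ 2} =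
        {ω | eveGain α y g (strongest α y g ω) ω ≤ t} := by
      ext ω
      simp only [mem_ofPred_eq]
      rw [ht, le_div_iff₀ (by positivity), mul_comm]
    rw [h1, hn.measureReal_strongest_le hlam.le hα ht0, ← Real.log_le_iff_le_exp hε]
    -- `Γ(s + 1) = s * Γ(s)` at `s = 2 / α` produces the constant of the final formula.
    have h2 : lam * (Real.pi * t ^ (-2 / α) * Real.Gamma (2 / α + 1)) =
        2 * Real.pi * lam * Real.Gamma (2 / α) / α * (t⁻¹) ^ (2 / α) := by
      rw [Real.Gamma_add_one (by positivity), neg_div, Real.rpow_neg ht0.le,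
        Real.inv_rpow ht0.le]
      field_simp
    have h3 : Real.log ε ≤ -(lam * (Real.pi * t ^ (-2 / α) * Real.Gamma (2 / α + 1))) ↔
        (t⁻¹) ^ (2 / α) ≤ A := by
      rw [h2, le_neg, hA, le_div_iff₀ (by positivity), one_div, Real.log_inv,
        div_mul_eq_mul_div, div_le_iff₀ hα0]
      constructor <;> intro H <;> linarith
    have h4 : (t⁻¹) ^ (2 / α) ≤ A ↔ t⁻¹ ≤ A ^ (α / 2) := by
      have : 2 / α = (α / 2)⁻¹ := by field_simp
      rw [this, Real.rpow_inv_le_iff_of_pos (inv_nonneg.2 ht0.le) hA0 (by positivity)]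
    rw [h3, h4, ht, inv_div, div_le_iff₀ (by positivity), div_mul_eq_mul_div,
      le_div_iff₀ hPt]
    constructor <;> intro H <;> linarith

end

end

/-! ### The optimal power split -/

theorem lemma3 {Ω : Type*} [MeasurableSpace Ω] (μ : Measure Ω) [IsProbabilityMeasure μ]
    (α lam Pt d σP σS βt βe ε : ℝ)
    (hα : 2 < α) (hlam : 0 < lam) (hPt : 0 < Pt) (hd : 0 < d) (hσP : 0 < σP) (hσS : 0 < σS)
    (hβt : 0 < βt) (hβe : 0 < βe) (hε : 0 < ε) (hε1 : ε ≤ 1)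
    (h : Ω → ℝ) (y : ℕ → Ω → Plane) (g : ℕ → Ω → ℝ)
    (hnet : IsFadingNetwork μ lam h y g) :
    (∀ᵐ ω ∂μ, ∃ i, IsStrongest α y g ω i) ∧
    ∀ γ : ℝ, IsOptimalSplit μ α Pt d σP σS βt βe ε h y g γ ↔
      γ = min 1 (βe / (1 + βe) * (1 + σS ^ 2 / Pt *
        (α * Real.log (1 / ε) / (2 * Real.pi * lam * Real.Gamma (2 / α))) ^ (α / 2))) := by
  have hα1 : 1 ≤ α := by linarith
  refine ⟨hnet.ae_exists_isStrongest hlam.le hα1, fun γ => ?_⟩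
  have hsec := fun c (hc : c ≤ 1) =>
    hnet.le_secProb_iff hα1 hlam hPt hσS hβe hε hε1 (γ := c) hc
  set γ₀ := βe / (1 + βe) * (1 + σS ^ 2 / Pt *
    (α * Real.log (1 / ε) / (2 * Real.pi * lam * Real.Gamma (2 / α))) ^ (α / 2)) with hγ₀
  have hγ₀pos : 0 ≤ γ₀ := by
    have hG := Real.Gamma_pos_of_pos (s := 2 / α) (by positivity)
    have hlog : 0 ≤ Real.log (1 / ε) := Real.log_nonneg (by rw [le_div_iff₀ hε]; linarith)
    positivity
  have hset : {c ∈ Icc (0 : ℝ) 1 | ε ≤ secProb μ α Pt σS βe y g c} = Icc 0 (min 1 γ₀) := by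
    ext c
    simp only [mem_ofPred_eq, mem_Icc, le_min_iff]
    constructor
    · rintro ⟨⟨h0, h1⟩, h2⟩; exact ⟨h0, h1, (hsec c h1).1 h2⟩
    · rintro ⟨h0, h1, h2⟩; exact ⟨⟨h0, h1⟩, (hsec c h1).2 h2⟩
  have hmono : StrictMonoOn (covProb μ α Pt d σP βt h) (Icc 0 (min 1 γ₀)) :=
    (hnet.strictMonoOn_covProb hPt hd hσP hβt).mono fun c hc => hc.1
  have hmem : min 1 γ₀ ∈ Icc 0 (min 1 γ₀) := ⟨le_min zero_le_one hγ₀pos, le_rfl⟩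
  rw [IsOptimalSplit, hset]
  constructor
  · rintro ⟨hγ, hmax⟩
    exact le_antisymm hγ.2 ((hmono.le_iff_le hmem hγ).1 (hmax hmem))
  · rintro rfl
    exact ⟨hmem, fun c hc => hmono.monotoneOn hc hmem hc.2⟩
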